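/- **Setting.** Let $H\ge 1$, $d\ge 1$. An episodic RL problem consists of measurable state and action spaces $\mathbb S,\mathbb A$, an initial distribution $\mu_0$, transition kernels $P_1,\dots,P_H$, and a measurable trajectory reward $r(\tau)\in[0,H]$ for $\tau=(s_h,a_h)_{h=1}^H$. A policy network assigns to $\theta\in\mathbb R^d$, a state and a step $h$ a distribution over actions (jointly measurably); $\pi_\theta$ is the induced policy and $V(\pi_\theta)=\mathbb E_{s_1\sim\mu_0}\mathbb E_{\pi_\theta}[r(\tau)\mid s_1]$. The link function $\sigma:\mathbb R\to[0,1]$ is strictly increasing on $[-H,H]$ with $\sigma(0)=\tfrac12$; human feedback on a pair $(\tau_1,\tau_0)$ is a Bernoulli bit with $\mathbb P(o=1)=\sigma(r(\tau_1)-r(\tau_0))$, different bits being conditionally independent. Put $\Delta=\min\{\sigma(-H),1-\sigma(H)\}$ and $\mathrm{trim}[a|\Delta]=\min\{\max\{a,\Delta\},1-\Delta\}$. Assume, with the same constant $L$, that $\sigma^{-1}$ is $L$-Lipschitz on $[\Delta,1-\Delta]$ and that $\theta\mapsto V(\pi_\theta)$ is $L$-smooth on $\mathbb R^d$ (differentiable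 with $L$-Lipschitz gradient). **Algorithms.** Given $\theta_0\in\mathbb R^d$, $\alpha,\mu>0$ and positive integers $T,M,N$, iteration $t=0,\dots,T-1$ draws a random unit vector $v_t$; draws $N$ independent trajectory pairs $\tau_{n,0}\sim\pi_{\theta_t}$, $\tau_{n,1}\sim\pi_{\theta_t+\mu v_t}$; queries $M$ independent feedback bits $o_{n,1},\dots,o_{n,M}$ on each pair $(\tau_{n,1},\tau_{n,0})$; puts $p_{t,n}=\mathrm{trim}[\frac1M\sum_m o_{n,m}|\Delta]$, $\hat g_t=\frac d\mu\big(\frac1N\sum_{n}\sigma^{-1}(p_{t,n})\big)v_t$ and $\theta_{t+1}=\theta_t+\alpha\hat g_t$. In ZPG, $v_t$ is uniform on the unit sphere. In ZBCPG with batch size $K\in\{1,\dots,d\}$, $v_t=K^{-1/2}\sum_{j=1}^K\lambda_{t,j}e_{i_{t,j}}$, where the $K$ coordinates are drawn uniformly without replacement and the $\lambda_{t,j}$ are independent uniform signs. The output is $\theta_R$ with $R$ uniform on $\{0,\dots,T-1\}$ and independent of the run. The algorithm uses $TMN$ preference queries. **Statement.** There is an absolute constant $C>0$ such that for all $d,H\ge1$,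 all $L$ and $\sigma$ as above, and all $0<\varepsilon\le d/2$, the following holds for ZPG, and for ZBCPG with every $K\in\{1,\dots,d\}$: there are hyper-parameters $\alpha,\mu>0$ and $T,M,N\ge1$ with $$TMN\;\le\; C\,L^7\,\frac{d^8H^3}{\varepsilon^5}\log\frac d\varepsilon$$ (so $TMN=O\big(\frac{d^8H^3}{\varepsilon^5}\log\frac d\varepsilon\big)$ with a constant depending only on $L$) such that for every RL problem, every policy network satisfying the assumptions, and every $\theta_0$, the output is $\varepsilon$-stationary in expectation: $$\mathbb E\big[\|\nabla_\theta V(\pi_{\theta_R})\|_2^2\big]\le\varepsilon .$$ -/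

import Mathlib

open MeasureTheory ProbabilityTheory Set
open scoped ENNReal NNReal Gradient

namespace RLHF

noncomputable section

/-! ### Episodic reinforcement learning with trajectory rewards -/

/-- A trajectory `{(s_h, a_h)}_{h = 1}^n`. -/
abbrev Trajectory (S A : Type*) (n : ℕ) : Type _ := Fin n → S × A

/-- The space `ℝ^d` of policy parameters with its Euclidean norm. -/
abbrev Param (d : ℕ) : Type := EuclideanSpace ℝ (Fin d)

/-- An episodic RL problem with horizon `H`: the initial distribution, the transition kernels
`P_1, …, P_H`, and a trajectory reward with values in `[0, H]`. -/
structure RLProblem (S A : Type*) [MeasurableSpace S] [MeasurableSpace A] (H : ℕ) where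
  init : Measure S
  trans : Fin H → Kernel (S × A) S
  reward : Trajectory S A H → ℝ
  init_isProb : IsProbabilityMeasure init
  trans_isMarkov : ∀ h, IsMarkovKernel (trans h)
  reward_measurable : Measurable reward
  reward_mem : ∀ τ, reward τ ∈ Icc (0 : ℝ) H

/-- A policy network: at each of the `H` decision steps it maps a parameter `θ ∈ ℝ^d` and a state
to a probability distribution over the actions, measurably. -/
structure PolicyNet (d : ℕ) (S A : Type*) [MeasurableSpace S] [MeasurableSpace A] (H : ℕ) where
  act : Fin H → Kernel (Param d × S) A
  act_isMarkov : ∀ h, IsMarkovKernel (act h)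

/-- The law of an `n`-step trajectory started in the state `s` under the policy `π_θ`, as a kernel
in `(θ, s)`: draw `a ∼ π_θ(s)`, then `s' ∼ P(s, a)`, then the remaining `n - 1` steps from `s'`. -/
def trajFrom {Θ S A : Type*} [MeasurableSpace Θ] [MeasurableSpace S] [MeasurableSpace A] :
    (n : ℕ) → (Fin n → Kernel (S × A) S) → (Fin n → Kernel (Θ × S) A) →
      Kernel (Θ × S) (Trajectory S A n)
  | 0, _, _ => Kernel.deterministic (fun _ => Fin.elim0) measurable_const
  | n + 1, P, π =>
      (Kernel.id ×ₖ
        ((π 0 ⊗ₖ (P 0).comap (fun x : (Θ × S) × A => (x.1.2, x.2)) (by fun_prop)) ⊗ₖ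
          (trajFrom n (fun h => P h.succ) (fun h => π h.succ)).comap
            (fun x : (Θ × S) × A × S => (x.1.1, x.2.2)) (by fun_prop))).map
        (fun y : (Θ × S) × (A × S) × Trajectory S A n =>
          (Fin.cons (y.1.2, y.2.1.1) y.2.2 : Trajectory S A (n + 1)))

theorem measurable_trajCons {X S A : Type*} [MeasurableSpace X] [MeasurableSpace S]
    [MeasurableSpace A] (n : ℕ) {f : X → S × A} {g : X → Trajectory S A n}
    (hf : Measurable f) (hg : Measurable g) :
    Measurable (fun x => (Fin.cons (f x) (g x) : Trajectory S A (n + 1))) := by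
  refine measurable_pi_iff.2 fun i => ?_
  refine Fin.cases ?_ (fun j => ?_) i
  · simpa using hf
  · simp only [Fin.cons_succ]
    exact (measurable_pi_apply j).comp hg

theorem isMarkovKernel_trajFrom {Θ S A : Type*} [MeasurableSpace Θ] [MeasurableSpace S]
    [MeasurableSpace A] : ∀ (n : ℕ) (P : Fin n → Kernel (S × A) S) (π : Fin n → Kernel (Θ × S) A),
      (∀ h, IsMarkovKernel (P h)) → (∀ h, IsMarkovKernel (π h)) → IsMarkovKernel (trajFrom n P π)
  | 0, _, _, _, _ => by
      unfold trajFrom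
      infer_instance
  | n + 1, P, π, hP, hπ => by
      have := hP 0
      have := hπ 0
      have := isMarkovKernel_trajFrom n (fun h => P h.succ) (fun h => π h.succ)
        (fun h => hP h.succ) (fun h => hπ h.succ)
      unfold trajFrom
      exact Kernel.IsMarkovKernel.map _ (measurable_trajCons n (by fun_prop) (by fun_prop))

variable {d H : ℕ} {S A : Type*} [MeasurableSpace S] [MeasurableSpace A]

/-- The law of a whole trajectory `τ ∼ π_θ`, as a kernel in `θ`. -/
def trajKernel (E : RLProblem S A H) (π : PolicyNet d S A H) :
    Kernel (Param d) (Trajectory S A H) :=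
  trajFrom H E.trans π.act ∘ₖ (Kernel.id ×ₖ Kernel.const (Param d) E.init)

instance (E : RLProblem S A H) (π : PolicyNet d S A H) : IsMarkovKernel (trajKernel E π) := by
  have := isMarkovKernel_trajFrom H E.trans π.act E.trans_isMarkov π.act_isMarkov
  have := E.init_isProb
  unfold trajKernel
  infer_instance

/-- `V_1^{π_θ}(s) = 𝔼[r(τ) | s_1 = s]`. -/
def valueFrom (E : RLProblem S A H) (π : PolicyNet d S A H) (θ : Param d) (s : S) : ℝ :=
  ∫ τ, E.reward τ ∂(trajFrom H E.trans π.act (θ, s))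

/-- `V(π_θ) = 𝔼_{s ∼ μ₀}[V_1^{π_θ}(s)]`. -/
def value (E : RLProblem S A H) (π : PolicyNet d S A H) (θ : Param d) : ℝ :=
  ∫ s, valueFrom E π θ s ∂E.init

/-- `f` is `L`-smooth: differentiable with `L`-Lipschitz gradient. -/
def IsSmoothWith (L : ℝ) (f : Param d → ℝ) : Prop :=
  Differentiable ℝ f ∧ ∀ x y, ‖∇ f x - ∇ f y‖ ≤ L * ‖x - y‖

/-! ### Human feedback -/

/-- A link function `σ : ℝ → [0, 1]`, strictly increasing on `[-H, H]` with `σ(0) = 1/2`. -/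
structure LinkFunction (H : ℕ) where
  toFun : ℝ → ℝ
  mem_Icc : ∀ x, toFun x ∈ Icc (0 : ℝ) 1
  strictMonoOn : StrictMonoOn toFun (Icc (-(H : ℝ)) H)
  map_zero : toFun 0 = 1 / 2

/-- The trim constant `Δ = min {σ(-H), 1 - σ(H)}`. -/
def LinkFunction.trimSize (σ : LinkFunction H) : ℝ := min (σ.toFun (-(H : ℝ))) (1 - σ.toFun H)

/-- `σinv` is an inverse of the link function, in the sense that it inverts `σ` on the range
`[-H, H]` of reward differences, and it is `L`-Lipschitz on `[Δ, 1 - Δ]`. -/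
structure IsLipschitzInverse (σ : LinkFunction H) (σinv : ℝ → ℝ) (L : ℝ) : Prop where
  leftInv : ∀ x ∈ Icc (-(H : ℝ)) H, σinv (σ.toFun x) = x
  lipschitz : ∀ p ∈ Icc σ.trimSize (1 - σ.trimSize), ∀ q ∈ Icc σ.trimSize (1 - σ.trimSize),
    |σinv p - σinv q| ≤ L * |p - q|

/-- `trim[a | Δ] = min {max {a, Δ}, 1 - Δ}`. -/
def trim (a Δ : ℝ) : ℝ := min (max a Δ) (1 - Δ)

/-- `ℙ(τ₁ ≻ τ₀) = σ(r(τ₁) - r(τ₀))` for the pair `x = (τ₀, τ₁)`. -/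
def prefProb (E : RLProblem S A H) (σ : LinkFunction H)
    (x : Trajectory S A H × Trajectory S A H) : ℝ :=
  σ.toFun (E.reward x.2 - E.reward x.1)

theorem measurable_prefProb (E : RLProblem S A H) (σ : LinkFunction H) :
    Measurable (prefProb E σ) := by
  have hH : (0 : ℝ) ≤ H := Nat.cast_nonneg H
  have hc : ∀ x : ℝ, max (-(H : ℝ)) (min (H : ℝ) x) ∈ Icc (-(H : ℝ)) H := fun x =>
    ⟨le_max_left _ _, max_le (by linarith) (min_le_left _ _)⟩
  have hm : Monotone fun x : ℝ => σ.toFun (max (-(H : ℝ)) (min (H : ℝ) x)) := fun x y hxy =>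
    σ.strictMonoOn.monotoneOn (hc x) (hc y) (max_le_max le_rfl (min_le_min le_rfl hxy))
  have h1 := E.reward_measurable
  have h2 : Measurable fun x : Trajectory S A H × Trajectory S A H =>
      E.reward x.2 - E.reward x.1 := by fun_prop
  convert hm.measurable.comp h2 using 1
  funext x
  have a := E.reward_mem x.1
  have b := E.reward_mem x.2
  simp only [prefProb, Function.comp]
  rw [min_eq_right (by linarith [a.1, b.2]), max_eq_right (by linarith [a.2, b.1])]

/-- One human feedback bit `o` for the pair `(τ₀, τ₁)`: a Bernoulli variable with
`ℙ(o = 1) = ℙ(τ₁ ≻ τ₀)`. -/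
def feedback (E : RLProblem S A H) (σ : LinkFunction H) :
    Kernel (Trajectory S A H × Trajectory S A H) Bool where
  toFun x := ENNReal.ofReal (prefProb E σ x) • Measure.dirac true +
    ENNReal.ofReal (1 - prefProb E σ x) • Measure.dirac false
  measurable' := by
    have h := measurable_prefProb E σ
    refine Measure.measurable_of_measurable_coe _ fun s _ => ?_
    simp only [Measure.coe_add, Measure.coe_smul, Pi.add_apply, Pi.smul_apply, smul_eq_mul]
    fun_prop

instance (E : RLProblem S A H) (σ : LinkFunction H) : IsMarkovKernel (feedback E σ) where
  isProbabilityMeasure x := ⟨by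
    have h := σ.mem_Icc (E.reward x.2 - E.reward x.1)
    simp only [feedback, Kernel.coe_mk, Measure.coe_add, Measure.coe_smul, Pi.add_apply,
      Pi.smul_apply, smul_eq_mul, measure_univ, mul_one, prefProb]
    rw [← ENNReal.ofReal_add h.1 (by linarith [h.2])]
    simp⟩

/-- `n` conditionally independent draws from a Markov kernel. -/
def iid {X Y : Type*} [MeasurableSpace X] [MeasurableSpace Y] (n : ℕ) (κ : Kernel X Y)
    [IsMarkovKernel κ] : Kernel X (Fin n → Y) where
  toFun x := Measure.pi fun _ => κ x
  measurable' := by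
    refine Measurable.measure_of_isPiSystem_of_isProbabilityMeasure
      (S := pi univ '' pi univ fun _ : Fin n => {s : Set Y | MeasurableSet s})
      generateFrom_pi.symm isPiSystem_pi ?_
    rintro _ ⟨s, hs, rfl⟩
    simp only [Measure.pi_pi]
    exact Finset.measurable_prod _ fun i _ => κ.measurable_coe (hs i (mem_univ i))

instance {X Y : Type*} [MeasurableSpace X] [MeasurableSpace Y] (n : ℕ) (κ : Kernel X Y)
    [IsMarkovKernel κ] : IsMarkovKernel (iid n κ) where
  isProbabilityMeasure x := by
    simp only [iid, Kernel.coe_mk]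
    infer_instance

/-- For a pair of parameters `(θ, θ')`: draw `τ₀ ∼ π_θ` and `τ₁ ∼ π_θ'` independently and query
`M` human evaluators with `(τ₁, τ₀)`; the output is the vector of the `M` feedback bits. -/
def queryPair (E : RLProblem S A H) (π : PolicyNet d S A H) (σ : LinkFunction H) (M : ℕ) :
    Kernel (Param d × Param d) (Fin M → Bool) :=
  iid M (feedback E σ) ∘ₖ (trajKernel E π ∥ₖ trajKernel E π)

instance (E : RLProblem S A H) (π : PolicyNet d S A H) (σ : LinkFunction H) (M : ℕ) :
    IsMarkovKernel (queryPair E π σ M) := by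
  unfold queryPair
  infer_instance

/-! ### The two algorithms -/

/-- Hyper-parameters: learning rate `α`, perturbation distance `μ`, number `T` of iterations,
number `M` of queries per trajectory pair, number `N` of trajectory pairs per iteration. -/
structure HyperParams where
  α : ℝ
  μ : ℝ
  T : ℕ
  M : ℕ
  N : ℕ
  α_pos : 0 < α
  μ_pos : 0 < μ
  T_pos : 0 < T
  M_pos : 0 < M
  N_pos : 0 < N

/-- The total number of human preference queries: `T` iterations, each of which queries `M` bits
for each of `N` trajectory pairs. -/
def HyperParams.queries (hp : HyperParams) : ℕ := hp.T * hp.M * hp.N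

/-- The estimate `p_{t,n}` of the comparison probability from `M` feedback bits. -/
def compProb (Δ : ℝ) {M : ℕ} (o : Fin M → Bool) : ℝ :=
  trim (∑ m, (if o m then (1 : ℝ) else 0) / M) Δ

/-- The gradient estimate `ĝ = (d / μ) · (∑ₙ σ⁻¹(pₙ)) / N · v`. -/
def gradEstimate (Δ : ℝ) (σinv : ℝ → ℝ) (μ : ℝ) {M N : ℕ} (v : Param d)
    (o : Fin N → Fin M → Bool) : Param d :=
  ((d : ℝ) / μ * ((∑ n, σinv (compProb Δ (o n))) / N)) • v

/-- One iteration `θ_t ↦ θ_{t+1}` as a Markov kernel: draw a perturbation `v` from `dir`, draw and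
query `N` independent trajectory pairs for `(θ, θ + μ v)`, and update `θ + α ĝ`. -/
def step (dir : Measure (Param d)) (E : RLProblem S A H) (π : PolicyNet d S A H)
    (σ : LinkFunction H) (σinv : ℝ → ℝ) (hp : HyperParams) : Kernel (Param d) (Param d) :=
  (Kernel.id ×ₖ
    (Kernel.const (Param d) dir ⊗ₖ
      (iid hp.N (queryPair E π σ hp.M)).comap
        (fun x : Param d × Param d => (x.1, x.1 + hp.μ • x.2)) (by fun_prop))).map
    (fun y : Param d × Param d × (Fin hp.N → Fin hp.M → Bool) =>
      y.1 + hp.α • gradEstimate σ.trimSize σinv hp.μ y.2.1 y.2.2)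

theorem measurable_update (Δ : ℝ) (σinv : ℝ → ℝ) (α μ : ℝ) (M N : ℕ) :
    Measurable (fun y : Param d × Param d × (Fin N → Fin M → Bool) =>
      y.1 + α • gradEstimate Δ σinv μ y.2.1 y.2.2) := by
  have h : Measurable fun o : Fin N → Fin M → Bool =>
      (d : ℝ) / μ * ((∑ n, σinv (compProb Δ (o n))) / N) := measurable_of_finite _
  unfold gradEstimate
  have h' := h.comp
    ((measurable_snd.comp measurable_snd : Measurable
      fun y : Param d × Param d × (Fin N → Fin M → Bool) => y.2.2))
  exact measurable_fst.add ((h'.smul (measurable_fst.comp measurable_snd)).const_smul α)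

instance (dir : Measure (Param d)) [IsProbabilityMeasure dir] (E : RLProblem S A H)
    (π : PolicyNet d S A H) (σ : LinkFunction H) (σinv : ℝ → ℝ) (hp : HyperParams) :
    IsMarkovKernel (step dir E π σ σinv hp) := by
  unfold step
  exact Kernel.IsMarkovKernel.map _ (measurable_update _ _ _ _ _ _)

/-- The law of the iterate `θ_t`, started at `θ₀`. -/
def iterateLaw (dir : Measure (Param d)) (E : RLProblem S A H) (π : PolicyNet d S A H)
    (σ : LinkFunction H) (σinv : ℝ → ℝ) (hp : HyperParams) (θ₀ : Param d) :
    ℕ → Measure (Param d)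
  | 0 => Measure.dirac θ₀
  | t + 1 => step dir E π σ σinv hp ∘ₘ iterateLaw dir E π σ σinv hp θ₀ t

/-- The law of the output `θ_R`, where `R` is uniform on `{0, …, T - 1}` and independent of the
run of the algorithm. -/
def outputLaw (dir : Measure (Param d)) (E : RLProblem S A H) (π : PolicyNet d S A H)
    (σ : LinkFunction H) (σinv : ℝ → ℝ) (hp : HyperParams) (θ₀ : Param d) :
    Measure (Param d) :=
  (hp.T : ℝ≥0∞)⁻¹ • ∑ t ∈ Finset.range hp.T, iterateLaw dir E π σ σinv hp θ₀ t

/-- Perturbation directions of ZPG: the uniform distribution on the unit sphere of `ℝ^d`. -/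
def sphereDir (d : ℕ) : Measure (Param d) :=
  (((volume : Measure (Param d)).toSphere univ)⁻¹ •
    (volume : Measure (Param d)).toSphere).map Subtype.val

/-- The perturbation `K^{-1/2} ∑ⱼ λⱼ e_{iⱼ}` for distinct coordinates `i` and signs `λ`. -/
def blockVector {d K : ℕ} (i : Fin K ↪ Fin d) (sgn : Fin K → ℤˣ) : Param d :=
  (1 / √(K : ℝ)) • ∑ j, (((sgn j : ℤˣ) : ℤ) : ℝ) • EuclideanSpace.single (i j) (1 : ℝ)

/-- Perturbation directions of ZBCPG: `K` coordinates are drawn uniformly without replacement, with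
independent uniform signs. -/
def blockDir (d K : ℕ) : Measure (Param d) :=
  (Fintype.card ((Fin K ↪ Fin d) × (Fin K → ℤˣ)) : ℝ≥0∞)⁻¹ •
    ∑ x : (Fin K ↪ Fin d) × (Fin K → ℤˣ), Measure.dirac (blockVector x.1 x.2)

theorem isProbabilityMeasure_sphereDir (hd : 1 ≤ d) : IsProbabilityMeasure (sphereDir d) := by
  have : Nonempty (Fin d) := ⟨⟨0, hd⟩⟩
  have hne : (volume : Measure (Param d)).toSphere ≠ 0 := Measure.toSphere_ne_zero _
  refine ⟨?_⟩
  rw [sphereDir, Measure.map_apply measurable_subtype_coe MeasurableSet.univ]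
  simp only [preimage_univ, Measure.smul_apply, smul_eq_mul]
  exact ENNReal.inv_mul_cancel (fun h => hne (Measure.measure_univ_eq_zero.1 h))
    (measure_ne_top _ _)

theorem isProbabilityMeasure_blockDir {K : ℕ} (hK : K ≤ d) :
    IsProbabilityMeasure (blockDir d K) := by
  have : Nonempty (Fin K ↪ Fin d) := ⟨Fin.castLEEmb hK⟩
  refine ⟨?_⟩
  simp only [blockDir, Measure.smul_apply, Measure.coe_finsetSum, Finset.sum_apply, measure_univ,
    Finset.sum_const, Finset.card_univ, nsmul_eq_mul, mul_one, smul_eq_mul]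
  exact ENNReal.inv_mul_cancel (Nat.cast_ne_zero.2 Fintype.card_ne_zero) (ENNReal.natCast_ne_top _)

theorem isProbabilityMeasure_outputLaw (dir : Measure (Param d)) [IsProbabilityMeasure dir]
    (E : RLProblem S A H) (π : PolicyNet d S A H) (σ : LinkFunction H) (σinv : ℝ → ℝ)
    (hp : HyperParams) (θ₀ : Param d) :
    IsProbabilityMeasure (outputLaw dir E π σ σinv hp θ₀) := by
  have h : ∀ t, IsProbabilityMeasure (iterateLaw dir E π σ σinv hp θ₀ t) := fun t => by
    induction t with
    | zero => exact Measure.dirac.isProbabilityMeasure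
    | succ t ih => rw [iterateLaw]; infer_instance
  refine ⟨?_⟩
  have hT : (hp.T : ℝ≥0∞) ≠ 0 := by exact_mod_cast hp.T_pos.ne'
  simp [outputLaw, ENNReal.inv_mul_cancel hT (ENNReal.natCast_ne_top _)]

/-- The law of the output `θ_R` of ZPG. -/
def zpgOutput (E : RLProblem S A H) (π : PolicyNet d S A H) (σ : LinkFunction H) (σinv : ℝ → ℝ)
    (hp : HyperParams) (θ₀ : Param d) : Measure (Param d) :=
  outputLaw (sphereDir d) E π σ σinv hp θ₀

/-- The law of the output `θ_R` of ZBCPG with coordinate batch size `K`. -/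
def zbcpgOutput (K : ℕ) (E : RLProblem S A H) (π : PolicyNet d S A H) (σ : LinkFunction H)
    (σinv : ℝ → ℝ) (hp : HyperParams) (θ₀ : Param d) : Measure (Param d) :=
  outputLaw (blockDir d K) E π σ σinv hp θ₀

/-- `𝔼[‖∇_θ V(π_θ)‖²]` for `θ` distributed according to `ν`, with values in `[0, ∞]`. -/
def expSqGrad (E : RLProblem S A H) (π : PolicyNet d S A H) (ν : Measure (Param d)) : ℝ≥0∞ :=
  ∫⁻ θ, ENNReal.ofReal (‖∇ (value E π) θ‖ ^ 2) ∂ν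

end

end RLHF

/-!
The convergence proof views each algorithm as stochastic gradient ascent on `V(π_θ)` with the
finite-difference estimate `ĝ = (d / μ) A v`, where `A` is the average over `N` trajectory pairs of
the inverse link of a trimmed frequency of `M` feedback bits. The theorem needs four facts.

* The inverse link is `L`-Lipschitz, trimming is a contraction towards the true comparison
  probability, and a frequency of `M` bits has variance at most `1 / (4 M)`. Hence each term of `A`
  has bias at most `L / (2 √M)` as an estimate of `V(θ + μ v) - V(θ)`, and averaging divides the
  variance by `N` (`queryPair_moments`, `iid_queryPair_moments`). No concentration inequality is
  needed, since only second moments enter.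
* Both laws of directions are isotropic: `‖v‖ = 1` and `𝔼 ⟪g, v⟫² = ‖g‖² / d`. This follows from
  invariance under permutations and sign changes of the coordinates, so ZPG and ZBCPG are covered
  by the same argument (`isIsotropicUnit_of_invariant`).
* By smoothness and isotropy, with `α = 1 / (8 L d)` and `M ≥ μ⁻⁴` one iteration increases the
  expected value by at least `α / 2 * ‖∇V‖² - α d (3 L² μ² + H² / (4 N μ²))`
  (`le_integral_value_step`). The value stays in `[0, H]`, so telescoping bounds the average of
  `𝔼 ‖∇V‖²` over the iterations (`sum_integral_le_of_drift`).
* The choice `μ² ≍ ε / (d L²)`, `T ≍ L d H / ε`, `M ≍ d² L⁴ / ε²`, `N ≍ d² L² H² / ε²` makes the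
  error at most `ε` with `T M N ≍ L⁷ d⁵ H³ / ε⁵` queries (`exists_hyperParams`), which is below the
  claimed bound because `d ≥ 1` and `d / ε ≥ 2`. That `T`, `M` and `N` are at least `1` before
  rounding, so that rounding up costs only a constant factor, uses `2 H ≤ L`, which follows
  from `σ ≤ 1` (`IsLipschitzInverse.two_mul_le`).
-/

namespace RLHF

/-! ### Averages of independent copies -/

section Averages

variable {Y : Type*} [MeasurableSpace Y] {P : Measure Y} [IsProbabilityMeasure P] {f : Y → ℝ}

theorem memLp_average_pi (n : ℕ) (hf : MemLp f 2 P) :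
    MemLp (fun o : Fin n → Y => (∑ i, f (o i)) / n) 2 (Measure.pi fun _ => P) := by
  have h : ∀ i : Fin n, MemLp (fun o : Fin n → Y => f (o i)) 2 (Measure.pi fun _ => P) :=
    fun i => hf.comp_measurePreserving (measurePreserving_eval (fun _ => P) i)
  simp_rw [div_eq_inv_mul]
  exact (memLp_finsetSum _ fun i _ => h i).const_mul _

theorem integral_average_pi {n : ℕ} (hn : 0 < n) (hf : Integrable f P) :
    ∫ o : Fin n → Y, (∑ i, f (o i)) / n ∂(Measure.pi fun _ => P) = ∫ y, f y ∂P := by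
  rw [integral_div, integral_finsetSum _ fun i _ =>
    integrable_comp_eval (μ := fun _ : Fin n => P) (i := i) hf]
  simp_rw [integral_comp_eval (μ := fun _ : Fin n => P) hf.aestronglyMeasurable]
  have : (n : ℝ) ≠ 0 := by positivity
  simp [this]

theorem variance_average_pi {n : ℕ} (hn : 0 < n) (hf : MemLp f 2 P) :
    Var[fun o : Fin n → Y => (∑ i, f (o i)) / n; Measure.pi fun _ => P] = Var[f; P] / n := by
  have h := variance_sum_pi (μ := fun _ : Fin n => P) (X := fun _ => f) fun _ => hf
  have h2 : (fun o : Fin n → Y => (∑ i, f (o i)) / n) =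
      fun o => (n : ℝ)⁻¹ * (∑ i, fun o : Fin n → Y => f (o i)) o := by
    funext o
    simp [div_eq_inv_mul]
  have : (n : ℝ) ≠ 0 := by positivity
  rw [h2, variance_const_mul, h]
  simp
  field_simp

/-- Jensen's inequality for the square. -/
theorem sq_integral_le (hf : MemLp f 2 P) : (∫ y, f y ∂P) ^ 2 ≤ ∫ y, f y ^ 2 ∂P := by
  have h := variance_nonneg f P
  rw [variance_eq_sub hf] at h
  simpa using h

end Averages

/-! ### Inverting the link on a trimmed frequency -/

section Feedback

variable {d H : ℕ} {S A : Type*} [MeasurableSpace S] [MeasurableSpace A]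

theorem LinkFunction.trimSize_le_half (σ : LinkFunction H) : σ.trimSize ≤ 1 / 2 := by
  have h0 : (0 : ℝ) ≤ H := Nat.cast_nonneg H
  have h := σ.strictMonoOn.monotoneOn (a := -(H : ℝ)) (b := 0) ⟨le_rfl, by linarith⟩
    ⟨by linarith, h0⟩ (by linarith)
  rw [σ.map_zero] at h
  exact (min_le_left _ _).trans h

theorem LinkFunction.mem_Icc_trimSize (σ : LinkFunction H) {x : ℝ}
    (hx : x ∈ Icc (-(H : ℝ)) H) : σ.toFun x ∈ Icc σ.trimSize (1 - σ.trimSize) := by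
  have h0 : (0 : ℝ) ≤ H := Nat.cast_nonneg H
  have h1 := σ.strictMonoOn.monotoneOn (a := -(H : ℝ)) ⟨le_rfl, by linarith⟩ hx hx.1
  have h2 := σ.strictMonoOn.monotoneOn (b := (H : ℝ)) hx ⟨by linarith, le_rfl⟩ hx.2
  have h3 : σ.trimSize ≤ σ.toFun (-(H : ℝ)) := min_le_left _ _
  have h4 : σ.trimSize ≤ 1 - σ.toFun H := min_le_right _ _
  exact ⟨by linarith, by linarith⟩

theorem trim_mem_Icc {Δ : ℝ} (hΔ : Δ ≤ 1 / 2) (a : ℝ) : trim a Δ ∈ Icc Δ (1 - Δ) :=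
  ⟨le_min (le_max_right _ _) (by linarith), min_le_right _ _⟩

/-- Trimming does not increase the distance to a point of the trimming interval. -/
theorem abs_trim_sub_le {Δ p : ℝ} (hp : p ∈ Icc Δ (1 - Δ)) (a : ℝ) :
    |trim a Δ - p| ≤ |a - p| := by
  have h : trim p Δ = p := by rw [trim, max_eq_left hp.1, min_eq_left hp.2]
  calc |trim a Δ - p| = |trim a Δ - trim p Δ| := by rw [h]
    _ ≤ |max a Δ - max p Δ| := (abs_min_sub_min_le_max _ _ _ _).trans (by simp)
    _ ≤ |a - p| := abs_max_sub_max_le_abs _ _ _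

/-- A link function takes values in `[0, 1]`, so an `L`-Lipschitz inverse forces `2 H ≤ L`. -/
theorem IsLipschitzInverse.two_mul_le {σ : LinkFunction H} {σinv : ℝ → ℝ} {L : ℝ}
    (h : IsLipschitzInverse σ σinv L) (hH : 1 ≤ H) : 2 * (H : ℝ) ≤ L := by
  have h0 : (1 : ℝ) ≤ H := by exact_mod_cast hH
  have m1 : (H : ℝ) ∈ Icc (-(H : ℝ)) H := ⟨by linarith, le_rfl⟩
  have m0 : (0 : ℝ) ∈ Icc (-(H : ℝ)) H := ⟨by linarith, by linarith⟩
  have hl := h.lipschitz _ (σ.mem_Icc_trimSize m1) _ (σ.mem_Icc_trimSize m0)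
  rw [h.leftInv _ m1, h.leftInv _ m0, σ.map_zero, sub_zero, abs_of_pos (by linarith)] at hl
  have hlt := σ.strictMonoOn m0 m1 (by linarith)
  rw [σ.map_zero] at hlt
  have h1 := (σ.mem_Icc H).2
  rw [abs_of_pos (by linarith)] at hl
  have hL : 0 < L := by
    by_contra hL
    nlinarith
  nlinarith

theorem integral_feedback (E : RLProblem S A H) (σ : LinkFunction H)
    (x : Trajectory S A H × Trajectory S A H) (f : Bool → ℝ) :
    ∫ o, f o ∂(feedback E σ x) =
      prefProb E σ x * f true + (1 - prefProb E σ x) * f false := by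
  have h := σ.mem_Icc (E.reward x.2 - E.reward x.1)
  simp only [feedback, Kernel.coe_mk]
  rw [integral_add_measure (Integrable.of_finite.smul_measure ENNReal.ofReal_ne_top)
    (Integrable.of_finite.smul_measure ENNReal.ofReal_ne_top), integral_smul_measure,
    integral_smul_measure, integral_dirac, integral_dirac,
    ENNReal.toReal_ofReal (by exact h.1), ENNReal.toReal_ofReal (by simpa [prefProb] using h.2)]
  simp

/-- The frequency of positive answers among `M` feedback bits estimates the comparison
probability with mean squared error at most `1 / (4 M)`. -/
theorem integral_sq_frequency_sub_le (E : RLProblem S A H) (σ : LinkFunction H) {M : ℕ}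
    (hM : 0 < M) (x : Trajectory S A H × Trajectory S A H) :
    ∫ o, ((∑ m, (if o m then (1 : ℝ) else 0) / M) - prefProb E σ x) ^ 2
      ∂(iid M (feedback E σ) x) ≤ 1 / (4 * M) := by
  set f : Bool → ℝ := fun o => if o then 1 else 0
  have hf : MemLp f 2 (feedback E σ x) := MemLp.of_discrete
  have hmean : ∫ o, f o ∂(feedback E σ x) = prefProb E σ x := by
    rw [integral_feedback]
    simp [f]
  have hvar : Var[f; feedback E σ x] ≤ 1 / 4 := by
    have hsq : ∫ o, f o ^ 2 ∂(feedback E σ x) = prefProb E σ x := by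
      rw [integral_feedback E σ x fun o => f o ^ 2]
      simp [f]
    rw [variance_eq_sub hf]
    simp only [Pi.pow_apply, hsq, hmean]
    nlinarith [sq_nonneg (prefProb E σ x - 1 / 2)]
  have hM' : (0 : ℝ) < M := by exact_mod_cast hM
  have hv := variance_average_pi hM hf
  have hi := integral_average_pi hM (hf.integrable one_le_two)
  rw [variance_eq_integral (memLp_average_pi M hf).aemeasurable, hi, hmean] at hv
  simp only [Finset.sum_div] at hv
  calc _ = Var[f; feedback E σ x] / M := hv
    _ ≤ 1 / 4 / M := by gcongr
    _ = 1 / (4 * M) := by rw [div_div]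

theorem reward_sub_mem_Icc (E : RLProblem S A H) (x : Trajectory S A H × Trajectory S A H) :
    E.reward x.2 - E.reward x.1 ∈ Icc (-(H : ℝ)) H := by
  have a := E.reward_mem x.1
  have b := E.reward_mem x.2
  exact ⟨by linarith [a.2, b.1], by linarith [a.1, b.2]⟩

/-- The inverse link of the trimmed frequency estimates the reward difference of a pair of
trajectories with mean squared error at most `L² / (4 M)`. -/
theorem integral_sq_inverse_link_sub_le (E : RLProblem S A H) {σ : LinkFunction H}
    {σinv : ℝ → ℝ} {L : ℝ} (hσ : IsLipschitzInverse σ σinv L) {M : ℕ} (hM : 0 < M)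
    (x : Trajectory S A H × Trajectory S A H) :
    ∫ o : Fin M → Bool, (σinv (compProb σ.trimSize o) - (E.reward x.2 - E.reward x.1)) ^ 2
      ∂(iid M (feedback E σ) x) ≤ L ^ 2 * (1 / (4 * M)) := by
  have hD := reward_sub_mem_Icc E x
  refine le_trans ?_ (mul_le_mul_of_nonneg_left (integral_sq_frequency_sub_le E σ hM x)
    (sq_nonneg L))
  rw [← integral_const_mul]
  refine integral_mono Integrable.of_finite Integrable.of_finite fun o => ?_
  have hp := σ.mem_Icc_trimSize hD
  have h1 := hσ.lipschitz _ (trim_mem_Icc σ.trimSize_le_half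
    (∑ m, (if o m then (1 : ℝ) else 0) / M)) _ hp
  rw [hσ.leftInv _ hD] at h1
  have h2 := abs_trim_sub_le hp (∑ m, (if o m then (1 : ℝ) else 0) / M)
  change (σinv (trim _ _) - _) ^ 2 ≤ L ^ 2 * (_ - σ.toFun _) ^ 2
  rw [← mul_pow]
  refine sq_le_sq.2 (h1.trans ?_)
  rw [abs_mul]
  exact mul_le_mul (le_abs_self L) h2 (abs_nonneg _) (abs_nonneg _)

theorem integrable_reward (E : RLProblem S A H) (ν : Measure (Trajectory S A H))
    [IsProbabilityMeasure ν] : Integrable E.reward ν :=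
  Integrable.of_mem_Icc 0 H E.reward_measurable.aemeasurable (ae_of_all _ E.reward_mem)

theorem value_eq_integral (E : RLProblem S A H) (π : PolicyNet d S A H) (θ : Param d) :
    value E π θ = ∫ τ, E.reward τ ∂(trajKernel E π θ) := by
  have := isMarkovKernel_trajFrom H E.trans π.act E.trans_isMarkov π.act_isMarkov
  have := E.init_isProb
  have hm : Measurable fun s : S => (θ, s) := by fun_prop
  rw [value, trajKernel, Kernel.integral_comp (by
    exact integrable_reward E ((trajFrom H E.trans π.act ∘ₖ
      (Kernel.id ×ₖ Kernel.const (Param d) E.init)) θ)),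
    Kernel.prod_apply, Kernel.id_apply, Kernel.const_apply, Measure.dirac_prod,
    integral_map hm.aemeasurable]
  · rfl
  · exact (E.reward_measurable.stronglyMeasurable.integral_kernel
      (κ := trajFrom H E.trans π.act)).aestronglyMeasurable

theorem value_mem_Icc (E : RLProblem S A H) (π : PolicyNet d S A H) (θ : Param d) :
    value E π θ ∈ Icc (0 : ℝ) H := by
  rw [value_eq_integral]
  refine ⟨integral_nonneg fun τ => (E.reward_mem τ).1, ?_⟩
  calc _ ≤ ∫ _, (H : ℝ) ∂(trajKernel E π θ) :=
        integral_mono (integrable_reward E _) (integrable_const _) fun τ => (E.reward_mem τ).2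
    _ = H := by simp

end Feedback

/-! ### Moments of the value-difference estimator -/

section Query

variable {d H : ℕ} {S A : Type*} [MeasurableSpace S] [MeasurableSpace A]

theorem integral_reward_sub (E : RLProblem S A H) (π : PolicyNet d S A H) (θ θ' : Param d) :
    ∫ x : Trajectory S A H × Trajectory S A H, (E.reward x.2 - E.reward x.1)
      ∂((trajKernel E π θ).prod (trajKernel E π θ')) = value E π θ' - value E π θ := by
  rw [integral_sub ((integrable_reward E _).comp_snd _) ((integrable_reward E _).comp_fst _),
    integral_fun_snd, integral_fun_fst, value_eq_integral, value_eq_integral]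
  simp

/-- The inverse link of the trimmed frequency estimates the difference of the values of two
parameters with bias at most `b`, and its second moment is at most `2 H² + 2 b²`. -/
theorem queryPair_moments (E : RLProblem S A H) (π : PolicyNet d S A H) {σ : LinkFunction H}
    {σinv : ℝ → ℝ} {L : ℝ} (hσ : IsLipschitzInverse σ σinv L) {M : ℕ} (hM : 0 < M) {b : ℝ}
    (hb : 0 ≤ b) (hLb : L ^ 2 * (1 / (4 * M)) ≤ b ^ 2) (θ θ' : Param d) :
    |∫ o : Fin M → Bool, σinv (compProb σ.trimSize o) ∂(queryPair E π σ M (θ, θ')) -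
        (value E π θ' - value E π θ)| ≤ b ∧
      ∫ o : Fin M → Bool, σinv (compProb σ.trimSize o) ^ 2 ∂(queryPair E π σ M (θ, θ')) ≤
        2 * (H : ℝ) ^ 2 + 2 * b ^ 2 := by
  set f : (Fin M → Bool) → ℝ := fun o => σinv (compProb σ.trimSize o) with hf
  set Q := (trajKernel E π θ).prod (trajKernel E π θ') with hQ
  set D : Trajectory S A H × Trajectory S A H → ℝ := fun x => E.reward x.2 - E.reward x.1 with hD
  have hint : ∀ g : (Fin M → Bool) → ℝ,
      ∫ o, g o ∂(queryPair E π σ M (θ, θ')) = ∫ x, ∫ o, g o ∂(iid M (feedback E σ) x) ∂Q := by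
    intro g
    rw [queryPair, Kernel.integral_comp (by
      change Integrable g (queryPair E π σ M (θ, θ'))
      exact Integrable.of_finite), Kernel.parallelComp_apply]
  have hgm : ∀ g : (Fin M → Bool) → ℝ,
      Integrable (fun x => ∫ o, g o ∂(iid M (feedback E σ) x)) Q := by
    intro g
    obtain ⟨C, hC⟩ := (Set.finite_range fun o => ‖g o‖).bddAbove
    refine Integrable.of_bound ((measurable_of_finite g).stronglyMeasurable.integral_kernel
      (κ := iid M (feedback E σ))).aestronglyMeasurable C (ae_of_all _ fun x => ?_)
    refine (norm_integral_le_of_norm_le_const (ae_of_all _ fun o => hC ⟨o, rfl⟩)).trans ?_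
    simp
  have hDm : Integrable D Q :=
    ((integrable_reward E _).comp_snd _).sub ((integrable_reward E _).comp_fst _)
  have hms : ∀ x, ∫ o, (f o - D x) ^ 2 ∂(iid M (feedback E σ) x) ≤ b ^ 2 := fun x =>
    (integral_sq_inverse_link_sub_le E hσ hM x).trans hLb
  constructor
  · rw [hint f, ← integral_reward_sub, ← integral_sub (hgm f) hDm]
    suffices hx : ∀ x, ‖∫ o, f o ∂(iid M (feedback E σ) x) - D x‖ ≤ b by
      calc _ ≤ b * Q.real univ := norm_integral_le_of_norm_le_const (ae_of_all _ hx)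
        _ = b := by rw [probReal_univ, mul_one]
    intro x
    -- The bias is at most the root of the mean squared error.
    have h1 := sq_integral_le (P := iid M (feedback E σ) x) (f := fun o => f o - D x)
      MemLp.of_discrete
    rw [integral_sub Integrable.of_finite (integrable_const _)] at h1
    simp only [integral_const, probReal_univ, one_smul] at h1
    exact abs_le_of_sq_le_sq (h1.trans (hms x)) hb
  · rw [hint fun o => f o ^ 2]
    calc _ ≤ ∫ _, (2 * (H : ℝ) ^ 2 + 2 * b ^ 2) ∂Q := by
          refine integral_mono (hgm fun o => f o ^ 2) (integrable_const _) fun x => ?_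
          have hDH : D x ^ 2 ≤ (H : ℝ) ^ 2 := sq_le_sq' (reward_sub_mem_Icc E x).1
            (reward_sub_mem_Icc E x).2
          calc ∫ o, f o ^ 2 ∂(iid M (feedback E σ) x)
              ≤ ∫ o, (2 * (H : ℝ) ^ 2 + 2 * (f o - D x) ^ 2) ∂(iid M (feedback E σ) x) :=
                integral_mono Integrable.of_finite Integrable.of_finite fun o => by
                  nlinarith [sq_nonneg (f o - 2 * D x)]
            _ = 2 * (H : ℝ) ^ 2 + 2 * ∫ o, (f o - D x) ^ 2 ∂(iid M (feedback E σ) x) := by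
                rw [integral_add (integrable_const _) Integrable.of_finite, integral_const,
                  integral_const_mul, probReal_univ, one_smul]
            _ ≤ _ := by linarith [hms x]
      _ = _ := by simp

/-- The mean `A` of `N` independent copies of the estimator: its bias and its second moment. -/
theorem iid_queryPair_moments (E : RLProblem S A H) (π : PolicyNet d S A H) {σ : LinkFunction H}
    {σinv : ℝ → ℝ} {L : ℝ} (hσ : IsLipschitzInverse σ σinv L) {M N : ℕ} (hM : 0 < M) (hN : 0 < N)
    {b : ℝ} (hb : 0 ≤ b) (hLb : L ^ 2 * (1 / (4 * M)) ≤ b ^ 2) (θ θ' : Param d) :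
    ∃ m : ℝ, |m - (value E π θ' - value E π θ)| ≤ b ∧
      ∫ o : Fin N → Fin M → Bool, (∑ n, σinv (compProb σ.trimSize (o n))) / N
        ∂(iid N (queryPair E π σ M) (θ, θ')) = m ∧
      ∫ o : Fin N → Fin M → Bool, ((∑ n, σinv (compProb σ.trimSize (o n))) / N) ^ 2
        ∂(iid N (queryPair E π σ M) (θ, θ')) ≤ m ^ 2 + (2 * (H : ℝ) ^ 2 + 2 * b ^ 2) / N := by
  obtain ⟨h1, h2⟩ := queryPair_moments E π hσ hM hb hLb θ θ'
  set f : (Fin M → Bool) → ℝ := fun o => σinv (compProb σ.trimSize o) with hf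
  have hf2 : MemLp f 2 (queryPair E π σ M (θ, θ')) := MemLp.of_discrete
  have hmean := integral_average_pi hN (hf2.integrable one_le_two)
  refine ⟨_, h1, hmean, ?_⟩
  have hv := variance_average_pi hN hf2
  rw [variance_eq_sub (memLp_average_pi N hf2)] at hv
  simp only [Pi.pow_apply] at hv
  rw [hmean] at hv
  have hv2 : Var[f; queryPair E π σ M (θ, θ')] ≤ 2 * (H : ℝ) ^ 2 + 2 * b ^ 2 :=
    (variance_le_expectation_sq hf2.aestronglyMeasurable).trans h2
  have hv3 := div_le_div_of_nonneg_right hv2 (Nat.cast_nonneg (α := ℝ) N)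
  change ∫ o : Fin N → Fin M → Bool, ((∑ n, f (o n)) / N) ^ 2
        ∂(Measure.pi fun _ => queryPair E π σ M (θ, θ')) ≤ _
  linarith

end Query

/-! ### Isotropic laws of directions -/

section Directions

/-- A law of random unit vectors with covariance matrix `d⁻¹ I`, stated through
`𝔼 ⟪g, v⟫² = ‖g‖² / d` for all `g`. -/
structure IsIsotropicUnit {d : ℕ} (dir : Measure (Param d)) : Prop where
  norm_eq_one : ∀ᵐ v ∂dir, ‖v‖ = 1
  integral_inner_sq : ∀ g : Param d, ∫ v, inner ℝ g v ^ 2 ∂dir = ‖g‖ ^ 2 / d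

variable {d : ℕ}

/-- The reflection of `ℝ^d` that changes the sign of the `i`-th coordinate. -/
noncomputable def coordFlip (i : Fin d) : Param d ≃ₗᵢ[ℝ] Param d :=
  LinearIsometryEquiv.piLpCongrRight 2 fun j =>
    if j = i then LinearIsometryEquiv.neg ℝ else LinearIsometryEquiv.refl ℝ ℝ

/-- The permutation of the coordinates of `ℝ^d` along `e`. -/
noncomputable def coordPerm (e : Equiv.Perm (Fin d)) : Param d ≃ₗᵢ[ℝ] Param d :=
  LinearIsometryEquiv.piLpCongrLeft 2 ℝ ℝ e

theorem coordFlip_apply (i j : Fin d) (v : Param d) :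
    coordFlip i v j = (if j = i then -1 else 1) * v j := by
  simp only [coordFlip, LinearIsometryEquiv.piLpCongrRight_apply]
  split_ifs <;> simp

theorem coordPerm_apply (e : Equiv.Perm (Fin d)) (j : Fin d) (v : Param d) :
    coordPerm e v j = v (e.symm j) := by
  simp [coordPerm, LinearIsometryEquiv.piLpCongrLeft_apply, Equiv.piCongrLeft']

theorem abs_coord_le_norm (v : Param d) (i : Fin d) : |v i| ≤ ‖v‖ := PiLp.norm_apply_le v i

/-- A law on the unit sphere that is invariant under sign changes and permutations of the
coordinates is isotropic: sign changes kill the mixed moments `𝔼[v_i v_j]`, permutations make all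
the moments `𝔼[v_i²]` equal, and these sum up to `1`. -/
theorem isIsotropicUnit_of_invariant {dir : Measure (Param d)} [IsProbabilityMeasure dir]
    (hnorm : ∀ᵐ v ∂dir, ‖v‖ = 1) (hflip : ∀ i, MeasurePreserving (coordFlip i) dir dir)
    (hperm : ∀ e, MeasurePreserving (coordPerm e) dir dir) : IsIsotropicUnit dir := by
  refine ⟨hnorm, fun g => ?_⟩
  have hint : ∀ i j : Fin d, Integrable (fun v : Param d => v i * v j) dir := by
    intro i j
    refine Integrable.of_bound (by fun_prop) 1 ?_
    filter_upwards [hnorm] with v hv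
    rw [norm_mul]
    have h1 := abs_coord_le_norm v i
    have h2 := abs_coord_le_norm v j
    rw [hv] at h1 h2
    exact mul_le_one₀ h1 (norm_nonneg _) h2
  have hoff : ∀ i j : Fin d, i ≠ j → ∫ v : Param d, v i * v j ∂dir = 0 := by
    intro i j hij
    have h := (hflip i).integral_comp (coordFlip i).toHomeomorph.measurableEmbedding
      fun v : Param d => v i * v j
    simp only [coordFlip_apply, if_true, if_neg hij.symm] at h
    have h' : ∫ v : Param d, -(v i * v j) ∂dir = ∫ v : Param d, v i * v j ∂dir := by
      rw [← h]
      congr 1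
      funext v
      ring
    rw [integral_neg] at h'
    linarith
  have hdiag : ∀ i j : Fin d, ∫ v : Param d, v i * v i ∂dir = ∫ v : Param d, v j * v j ∂dir := by
    intro i j
    have h := (hperm (Equiv.swap i j)).integral_comp
      (coordPerm (Equiv.swap i j)).toHomeomorph.measurableEmbedding
      fun v : Param d => v i * v i
    simpa [coordPerm_apply] using h.symm
  have hsum : ∑ i, ∫ v : Param d, v i * v i ∂dir = 1 := by
    rw [← integral_finsetSum _ fun i _ => hint i i]
    have : (fun v : Param d => ∑ i, v i * v i) =ᵐ[dir] fun _ => 1 := by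
      filter_upwards [hnorm] with v hv
      have := EuclideanSpace.real_norm_sq_eq v
      rw [hv] at this
      simpa [sq] using this.symm
    rw [integral_congr_ae this]
    simp
  have hval : ∀ i : Fin d, ∫ v : Param d, v i * v i ∂dir = 1 / d := by
    intro i
    rw [Finset.sum_congr rfl fun j _ => hdiag j i] at hsum
    have hd : (d : ℝ) ≠ 0 := by
      have := i.pos
      positivity
    simp only [Finset.sum_const, Finset.card_univ, Fintype.card_fin, nsmul_eq_mul] at hsum
    rw [eq_div_iff hd, mul_comm]
    exact hsum
  have hexp : ∀ v : Param d, inner ℝ g v ^ 2 = ∑ i, ∑ j, (g i * g j) * (v i * v j) := by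
    intro v
    rw [sq, PiLp.inner_apply, Finset.sum_mul_sum]
    refine Finset.sum_congr rfl fun i _ => Finset.sum_congr rfl fun j _ => ?_
    simp only [RCLike.inner_apply, conj_trivial]
    ring
  simp_rw [hexp]
  rw [integral_finsetSum _ fun i _ => integrable_finsetSum _ fun j _ => (hint i j).const_mul _,
    EuclideanSpace.real_norm_sq_eq, Finset.sum_div]
  refine Finset.sum_congr rfl fun i _ => ?_
  rw [integral_finsetSum _ fun j _ => (hint i j).const_mul _, Finset.sum_eq_single i]
  · rw [integral_const_mul, hval]
    ring
  · intro j _ hj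
    rw [integral_const_mul, hoff i j hj.symm, mul_zero]
  · simp

/-! ### The uniform distribution on the sphere -/

open scoped Pointwise in
/-- The uniform distribution of a set `s` is the normalized volume of the cone over `s`. -/
theorem sphereDir_apply {s : Set (Param d)} (hs : MeasurableSet s) :
    sphereDir d s = ((volume : Measure (Param d)).toSphere univ)⁻¹ *
      (d * volume (Ioo (0 : ℝ) 1 • (Metric.sphere (0 : Param d) 1 ∩ s))) := by
  rw [sphereDir, Measure.map_apply measurable_subtype_coe hs, Measure.smul_apply, smul_eq_mul,
    Measure.toSphere_apply' _ (measurable_subtype_coe hs), Subtype.image_preimage_coe]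
  simp

open scoped Pointwise in
/-- The cone over a subset of the sphere is mapped by a linear isometry to the cone over the image,
and linear isometries preserve the volume. -/
theorem measurePreserving_sphereDir (U : Param d ≃ₗᵢ[ℝ] Param d) :
    MeasurePreserving U (sphereDir d) (sphereDir d) := by
  refine ⟨U.continuous.measurable, Measure.ext fun s hs => ?_⟩
  have hU : Measurable U := U.continuous.measurable
  rw [Measure.map_apply hU hs, sphereDir_apply (hU hs), sphereDir_apply hs]
  have hset : Ioo (0 : ℝ) 1 • (Metric.sphere (0 : Param d) 1 ∩ U ⁻¹' s) =
      U ⁻¹' (Ioo (0 : ℝ) 1 • (Metric.sphere (0 : Param d) 1 ∩ s)) := by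
    ext x
    simp only [mem_smul, mem_preimage, mem_inter_iff, mem_sphere_zero_iff_norm]
    constructor
    · rintro ⟨r, hr, y, ⟨hy, hys⟩, rfl⟩
      exact ⟨r, hr, U y, ⟨by simpa using hy, hys⟩, by simp⟩
    · rintro ⟨r, hr, y, ⟨hy, hys⟩, h⟩
      refine ⟨r, hr, U.symm y, ⟨by simpa using hy, by simpa using hys⟩, ?_⟩
      apply U.injective
      rw [← h]
      simp
  rw [hset, U.measurePreserving.measure_preimage_emb U.toHomeomorph.measurableEmbedding]

theorem isIsotropicUnit_sphereDir (hd : 1 ≤ d) : IsIsotropicUnit (sphereDir d) := by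
  have := isProbabilityMeasure_sphereDir hd
  refine isIsotropicUnit_of_invariant ?_ (fun i => measurePreserving_sphereDir _)
    fun e => measurePreserving_sphereDir _
  rw [sphereDir, ae_map_iff measurable_subtype_coe.aemeasurable
    (measurableSet_eq_fun measurable_norm measurable_const)]
  exact ae_of_all _ fun v => by simp

/-! ### Random coordinate blocks with random signs -/

variable {K : ℕ}

theorem blockVector_apply (i : Fin K ↪ Fin d) (sgn : Fin K → ℤˣ) (k : Fin d) :
    blockVector i sgn k = 1 / √(K : ℝ) *
      ∑ j, (((sgn j : ℤˣ) : ℤ) : ℝ) * if k = i j then 1 else 0 := by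
  simp [blockVector, Pi.single_apply]

theorem norm_blockVector (hK : 1 ≤ K) (i : Fin K ↪ Fin d) (sgn : Fin K → ℤˣ) :
    ‖blockVector i sgn‖ = 1 := by
  have h : ∀ j, (((sgn j : ℤˣ) : ℤ) : ℝ) * (((sgn j : ℤˣ) : ℤ) : ℝ) = 1 := by
    intro j
    rcases Int.units_eq_one_or (sgn j) with h | h <;> simp [h]
  have hs : ‖blockVector i sgn‖ ^ 2 = 1 := by
    rw [← real_inner_self_eq_norm_sq, blockVector, inner_smul_left, inner_smul_right, inner_sum]
    simp only [sum_inner, inner_smul_left, inner_smul_right, EuclideanSpace.inner_single_left,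
      PiLp.single_apply, conj_trivial, EmbeddingLike.apply_eq_iff_eq, mul_ite, mul_one,
      mul_zero, Finset.sum_ite_eq', Finset.mem_univ, if_true, h]
    have hK' : (0 : ℝ) < K := by exact_mod_cast hK
    simp only [Finset.sum_const, Finset.card_univ, Fintype.card_fin, nsmul_eq_mul, mul_one]
    rw [← mul_assoc, ← sq, div_pow, Real.sq_sqrt hK'.le]
    field_simp
  nlinarith [norm_nonneg (blockVector i sgn)]

/-- A map that permutes the equally likely pairs of coordinates and signs preserves the law. -/
theorem measurePreserving_blockDir {U : Param d → Param d} (hU : Measurable U)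
    (e : Equiv.Perm ((Fin K ↪ Fin d) × (Fin K → ℤˣ)))
    (h : ∀ x, U (blockVector x.1 x.2) = blockVector (e x).1 (e x).2) :
    MeasurePreserving U (blockDir d K) (blockDir d K) := by
  refine ⟨hU, ?_⟩
  rw [blockDir, Measure.map_smul, Measure.map_finset_sum hU.aemeasurable]
  congr 1
  simp_rw [Measure.map_dirac' hU, h]
  exact Equiv.sum_comp e fun x => Measure.dirac (blockVector x.1 x.2)

theorem isIsotropicUnit_blockDir (hK : 1 ≤ K) (hKd : K ≤ d) : IsIsotropicUnit (blockDir d K) := by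
  have := isProbabilityMeasure_blockDir hKd
  refine isIsotropicUnit_of_invariant ?_ (fun k => ?_) fun e => ?_
  · refine Measure.ae_smul_measure ?_ _
    rw [ae_finsetSum_measure_iff]
    intro x _
    rw [ae_dirac_iff (measurableSet_eq_fun measurable_norm measurable_const)]
    exact norm_blockVector hK _ _
  -- Flipping the `k`-th coordinate amounts to flipping the sign that was drawn with it.
  · let f : ((Fin K ↪ Fin d) × (Fin K → ℤˣ)) → ((Fin K ↪ Fin d) × (Fin K → ℤˣ)) :=
      fun x => (x.1, fun j => if x.1 j = k then -x.2 j else x.2 j)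
    have hf : Function.Involutive f := by
      rintro ⟨i, s⟩
      simp only [f, Prod.mk.injEq, true_and]
      funext j
      split_ifs <;> simp
    refine measurePreserving_blockDir (coordFlip k).continuous.measurable hf.toPerm ?_
    rintro ⟨i, s⟩
    ext l
    rw [coordFlip_apply, blockVector_apply, blockVector_apply, mul_left_comm, Finset.mul_sum]
    congr 1
    refine Finset.sum_congr rfl fun j _ => ?_
    simp only [Function.Involutive.coe_toPerm, f]
    by_cases hl : l = i j
    · subst hl
      by_cases hk : i j = k <;> simp [hk]
    · simp [hl]
  · refine measurePreserving_blockDir (coordPerm e).continuous.measurable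
      (Equiv.prodCongr (Equiv.embeddingCongr (Equiv.refl _) e) (Equiv.refl _)) ?_
    rintro ⟨i, s⟩
    ext l
    rw [coordPerm_apply, blockVector_apply, blockVector_apply]
    congr 1
    refine Finset.sum_congr rfl fun j _ => ?_
    simp [Equiv.symm_apply_eq]

end Directions

/-! ### Expected ascent in one iteration -/

section Ascent

variable {d H : ℕ} {S A : Type*} [MeasurableSpace S] [MeasurableSpace A]

/-- First-order Taylor bound. The mean value inequality gives the constant `L` instead of the
optimal `L / 2`, which suffices. -/
theorem IsSmoothWith.abs_sub_inner_le {L : ℝ} (hL : 0 ≤ L) {f : Param d → ℝ}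
    (hf : IsSmoothWith L f) (x y : Param d) :
    |f y - f x - inner ℝ (∇ f x) (y - x)| ≤ L * ‖y - x‖ ^ 2 := by
  have h := Convex.norm_image_sub_le_of_norm_hasFDerivWithin_le' (𝕜 := ℝ) (f := f)
    (f' := fderiv ℝ f) (φ := fderiv ℝ f x) (C := L * ‖y - x‖)
    (s := Metric.closedBall x ‖y - x‖) (x := x) (y := y)
    (fun z _ => (hf.1 z).hasFDerivAt.hasFDerivWithinAt) (fun z hz => ?_)
    (convex_closedBall _ _) (Metric.mem_closedBall_self (norm_nonneg _))
    (by simp [dist_eq_norm])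
  · have hi : inner ℝ (∇ f x) (y - x) = fderiv ℝ f x (y - x) := by
      rw [gradient, InnerProductSpace.toDual_symm_apply]
    rw [hi, sq, ← mul_assoc]
    exact h
  · have h1 := hf.2 z x
    rw [gradient, gradient, ← map_sub, LinearIsometryEquiv.norm_map] at h1
    refine h1.trans (mul_le_mul_of_nonneg_left ?_ hL)
    simpa [dist_eq_norm] using hz

theorem IsSmoothWith.measurable_gradient {L : ℝ} {f : Param d → ℝ}
    (hf : IsSmoothWith L f) : Measurable fun θ => ‖∇ f θ‖ ^ 2 := by
  have h : LipschitzWith L.toNNReal (∇ f) := LipschitzWith.of_dist_le_mul fun x y => by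
    rw [dist_eq_norm, dist_eq_norm]
    exact (hf.2 x y).trans (mul_le_mul_of_nonneg_right (Real.le_coe_toNNReal L) (norm_nonneg _))
  exact (h.continuous.norm.pow 2).measurable

/-- The expectation after one iteration, as an iterated integral over the direction and the feedback
bits. -/
theorem integral_step (dir : Measure (Param d)) [IsProbabilityMeasure dir] (E : RLProblem S A H)
    (π : PolicyNet d S A H) (σ : LinkFunction H) (σinv : ℝ → ℝ) (hp : HyperParams) (θ : Param d)
    {F : Param d → ℝ} (hF : Measurable F) {C : ℝ} (hC : ∀ θ, |F θ| ≤ C) :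
    Integrable (fun v => ∫ o, F (θ + hp.α • gradEstimate σ.trimSize σinv hp.μ v o)
      ∂(iid hp.N (queryPair E π σ hp.M) (θ, θ + hp.μ • v))) dir ∧
    ∫ θ', F θ' ∂(step dir E π σ σinv hp θ) =
      ∫ v, ∫ o, F (θ + hp.α • gradEstimate σ.trimSize σinv hp.μ v o)
        ∂(iid hp.N (queryPair E π σ hp.M) (θ, θ + hp.μ • v)) ∂dir := by
  have hm := measurable_update (d := d) σ.trimSize σinv hp.α hp.μ hp.M hp.N
  have hFm : Measurable fun y : Param d × Param d × (Fin hp.N → Fin hp.M → Bool) =>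
      F (y.1 + hp.α • gradEstimate σ.trimSize σinv hp.μ y.2.1 y.2.2) := hF.comp hm
  have hint : Integrable (fun y : Param d × (Fin hp.N → Fin hp.M → Bool) =>
      F (θ + hp.α • gradEstimate σ.trimSize σinv hp.μ y.1 y.2))
      ((Kernel.const (Param d) dir ⊗ₖ (iid hp.N (queryPair E π σ hp.M)).comap
        (fun x : Param d × Param d => (x.1, x.1 + hp.μ • x.2)) (by fun_prop)) θ) :=
    Integrable.of_bound (hFm.comp measurable_prodMk_left).aestronglyMeasurable C
      (ae_of_all _ fun y => hC _)
  constructor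
  · simpa using hint.integral_compProd
  · rw [step, Kernel.map_apply _ hm, integral_map hm.aemeasurable hF.aestronglyMeasurable,
      Kernel.prod_apply, Kernel.id_apply, Measure.dirac_prod,
      integral_map measurable_prodMk_left.aemeasurable hFm.aestronglyMeasurable,
      integral_compProd hint]
    simp

/-- The scalar inequality behind one ascent step along `v`: `s` is the directional derivative, `m`
the mean of the estimate of the increment `V(θ + μ v) - V(θ)`, and `Q` its second moment. -/
theorem ascent_scalar_bound {D L μ s m Q W N : ℝ} (hD : 0 < D) (hL : 0 < L) (hμ : 0 < μ)
    (hN : 1 ≤ N) (hm : |m - μ * s| ≤ 3 / 2 * (L * μ ^ 2))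
    (hQ : Q ≤ m ^ 2 + (2 * W ^ 2 + 2 * (L * μ ^ 2 / 2) ^ 2) / N) :
    1 / (8 * L * D) * D * (s ^ 2 / 2 - (3 * L ^ 2 * μ ^ 2 + W ^ 2 / (4 * N * μ ^ 2))) ≤
      1 / (8 * L * D) * (D / μ) * s * m - L * (1 / (8 * L * D) * (D / μ)) ^ 2 * Q := by
  -- `r` is the error of `m / μ` as an estimate of the directional derivative.
  set r : ℝ := (m - μ * s) / μ with hr
  have hmr : m = μ * (s + r) := by
    rw [hr]
    field_simp
    ring
  have hr2 : r ^ 2 ≤ 9 / 4 * (L ^ 2 * μ ^ 2) := by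
    have h : |r| ≤ 3 / 2 * (L * μ) := by
      rw [hr, abs_div, abs_of_pos hμ, div_le_iff₀ hμ]
      linarith
    have := sq_le_sq' (abs_le.1 h).1 (abs_le.1 h).2
    linarith
  have hQ' : Q / (8 * μ ^ 2) ≤
      (s + r) ^ 2 / 8 + (W ^ 2 / (4 * N * μ ^ 2) + L ^ 2 * μ ^ 2 / 16) := by
    calc Q / (8 * μ ^ 2) ≤ (m ^ 2 + (2 * W ^ 2 + 2 * (L * μ ^ 2 / 2) ^ 2) / N) / (8 * μ ^ 2) := by
          gcongr
      _ = (s + r) ^ 2 / 8 + (W ^ 2 / (4 * N * μ ^ 2) + L ^ 2 * μ ^ 2 / 16 / N) := by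
          rw [hmr]
          field_simp
          ring
      _ ≤ _ := by
          have := div_le_self (a := L ^ 2 * μ ^ 2 / 16) (by positivity) hN
          linarith
  have hmain : s ^ 2 / 2 - (3 * L ^ 2 * μ ^ 2 + W ^ 2 / (4 * N * μ ^ 2)) ≤
      s * (s + r) - Q / (8 * μ ^ 2) := by
    nlinarith [sq_nonneg (s + 3 / 2 * r), sq_nonneg (L * μ)]
  calc _ ≤ 1 / (8 * L * D) * D * (s * (s + r) - Q / (8 * μ ^ 2)) := by gcongr
    _ = _ := by
      rw [hmr]
      field_simp

/-- One iteration increases the expected value by at least `α ‖∇V‖² / 2` up to an error that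
consists of the squared bias of the finite difference and of the link, and of the variance. -/
theorem le_integral_value_step {dir : Measure (Param d)} [IsProbabilityMeasure dir]
    (hdir : IsIsotropicUnit dir) (hd : 1 ≤ d) (E : RLProblem S A H) (π : PolicyNet d S A H)
    {σ : LinkFunction H} {σinv : ℝ → ℝ} {L : ℝ} (hL : 0 < L) (hσ : IsLipschitzInverse σ σinv L)
    (hV : IsSmoothWith L (value E π)) (hp : HyperParams) (hα : hp.α = 1 / (8 * L * d))
    (hM : 1 / (hp.M : ℝ) ≤ hp.μ ^ 4) (θ : Param d) :
    value E π θ + hp.α / 2 * ‖∇ (value E π) θ‖ ^ 2 -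
        hp.α * d * (3 * L ^ 2 * hp.μ ^ 2 + (H : ℝ) ^ 2 / (4 * hp.N * hp.μ ^ 2)) ≤
      ∫ θ', value E π θ' ∂(step dir E π σ σinv hp θ) := by
  have hd' : (0 : ℝ) < d := by exact_mod_cast hd
  have hμ := hp.μ_pos
  have hN : (1 : ℝ) ≤ hp.N := by exact_mod_cast hp.N_pos
  obtain ⟨hint, heq⟩ := integral_step dir E π σ σinv hp θ (F := value E π)
    hV.1.continuous.measurable (C := H) fun θ' => by
      have := value_mem_Icc E π θ'
      rw [abs_of_nonneg this.1]
      exact this.2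
  rw [heq]
  set g := ∇ (value E π) θ with hg
  set e := 3 * L ^ 2 * hp.μ ^ 2 + (H : ℝ) ^ 2 / (4 * hp.N * hp.μ ^ 2) with he
  have hins : Integrable (fun v => inner ℝ g v ^ 2) dir := by
    refine Integrable.of_bound (by fun_prop) (‖g‖ ^ 2) ?_
    filter_upwards [hdir.norm_eq_one] with v hv
    rw [norm_pow]
    have := norm_inner_le_norm (𝕜 := ℝ) g v
    rw [hv, mul_one] at this
    gcongr
  have hsub : Integrable (fun v => hp.α * d * (inner ℝ g v ^ 2 / 2 - e)) dir :=
    ((hins.div_const 2).sub (integrable_const _)).const_mul _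
  have hlow : Integrable (fun v => value E π θ + hp.α * d * (inner ℝ g v ^ 2 / 2 - e)) dir :=
    (integrable_const _).add hsub
  have hval : ∫ v, (value E π θ + hp.α * d * (inner ℝ g v ^ 2 / 2 - e)) ∂dir =
      value E π θ + hp.α / 2 * ‖g‖ ^ 2 - hp.α * d * e := by
    rw [integral_add (integrable_const _) hsub,
      integral_const_mul, integral_sub (hins.div_const 2) (integrable_const _), integral_div,
      hdir.integral_inner_sq]
    simp only [integral_const, probReal_univ, one_smul]
    field_simp
    ring
  rw [← hval]
  refine integral_mono_ae hlow hint ?_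
  filter_upwards [hdir.norm_eq_one] with v hv
  set s := inner ℝ g v with hs
  have hLb : L ^ 2 * (1 / (4 * hp.M)) ≤ (L * hp.μ ^ 2 / 2) ^ 2 := by
    have : L ^ 2 * (1 / (4 * hp.M)) = L ^ 2 / 4 * (1 / (hp.M : ℝ)) := by
      rw [one_div, one_div, mul_inv]
      ring
    rw [this]
    calc _ ≤ L ^ 2 / 4 * hp.μ ^ 4 := by gcongr
      _ = _ := by ring
  -- For a fixed unit direction `v`, compare with the quadratic lower bound along `v`.
  obtain ⟨m, hm, hmean, hsq⟩ := iid_queryPair_moments E π hσ hp.M_pos hp.N_pos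
    (b := L * hp.μ ^ 2 / 2) (by positivity) hLb θ (θ + hp.μ • v)
  set ν := iid hp.N (queryPair E π σ hp.M) (θ, θ + hp.μ • v) with hν
  set X : (Fin hp.N → Fin hp.M → Bool) → ℝ :=
    fun o => (∑ n, σinv (compProb σ.trimSize (o n))) / hp.N with hX
  have hfd := hV.abs_sub_inner_le hL.le θ (θ + hp.μ • v)
  rw [add_sub_cancel_left, inner_smul_right, norm_smul, hv, mul_one, Real.norm_eq_abs, sq_abs,
    ← hg, ← hs] at hfd
  have hms : |m - hp.μ * s| ≤ 3 / 2 * (L * hp.μ ^ 2) := by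
    rw [abs_le] at hm hfd ⊢
    constructor <;> linarith
  have hsc := ascent_scalar_bound (D := d) hd' hL hμ hN hms hsq
  rw [← hα, ← he] at hsc
  have hpt : ∀ o, value E π θ + (hp.α * (d / hp.μ) * s * X o -
      L * (hp.α * (d / hp.μ)) ^ 2 * X o ^ 2) ≤
      value E π (θ + hp.α • gradEstimate σ.trimSize σinv hp.μ v o) := by
    intro o
    have h := hV.abs_sub_inner_le hL.le θ
      (θ + hp.α • gradEstimate σ.trimSize σinv hp.μ v o)
    have hge : hp.α • gradEstimate σ.trimSize σinv hp.μ v o = (hp.α * (d / hp.μ) * X o) • v := by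
      rw [gradEstimate, smul_smul, ← mul_assoc]
    rw [add_sub_cancel_left, hge, inner_smul_right, norm_smul, hv, mul_one, Real.norm_eq_abs,
      sq_abs, ← hg, ← hs] at h
    rw [hge]
    have := (abs_le.1 h).1
    linarith
  calc value E π θ + hp.α * d * (s ^ 2 / 2 - e)
      ≤ value E π θ + (hp.α * (d / hp.μ) * s * m -
        L * (hp.α * (d / hp.μ)) ^ 2 * ∫ o, X o ^ 2 ∂ν) := by linarith
    _ = ∫ o, (value E π θ + (hp.α * (d / hp.μ) * s * X o -
        L * (hp.α * (d / hp.μ)) ^ 2 * X o ^ 2)) ∂ν := by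
      rw [integral_add (integrable_const _) Integrable.of_finite,
        integral_sub Integrable.of_finite Integrable.of_finite, integral_const_mul,
        integral_const_mul, hmean, integral_const, probReal_univ, one_smul]
    _ ≤ _ := integral_mono Integrable.of_finite Integrable.of_finite hpt

end Ascent

/-! ### Telescoping over the iterations -/

section Iteration

/-- Telescoping along a Markov chain: if one step increases the expectation of a function `F` with
values in `[0, B]` by at least `a G - c`, then `G` is on average at most `(B / T + c) / a` along the
first `T` laws of the chain. -/
theorem sum_integral_le_of_drift {X : Type*} [MeasurableSpace X] (κ : Kernel X X)
    [IsMarkovKernel κ] (ν : ℕ → Measure X) [IsProbabilityMeasure (ν 0)]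
    (hν : ∀ t, ν (t + 1) = κ ∘ₘ ν t) {F G : X → ℝ} (hF : Measurable F) (hG : Measurable G)
    {B a c : ℝ} (hFB : ∀ x, F x ∈ Icc 0 B) (hG0 : ∀ x, 0 ≤ G x) (ha : 0 < a)
    (hdrift : ∀ x, F x + a * G x - c ≤ ∫ y, F y ∂(κ x)) (T : ℕ) :
    ∑ t ∈ Finset.range T, ∫⁻ x, ENNReal.ofReal (G x) ∂(ν t) ≤
      ENNReal.ofReal ((B + T * c) / a) := by
  have hprob : ∀ t, IsProbabilityMeasure (ν t) := fun t => by
    induction t with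
    | zero => infer_instance
    | succ t ih =>
      rw [hν]
      infer_instance
  have hFint : ∀ (ρ : Measure X) [IsProbabilityMeasure ρ], Integrable F ρ := fun ρ _ =>
    Integrable.of_mem_Icc 0 B hF.aemeasurable (ae_of_all _ hFB)
  have hFle : ∀ (ρ : Measure X) [IsProbabilityMeasure ρ], ∫ x, F x ∂ρ ∈ Icc 0 B := fun ρ _ =>
    ⟨integral_nonneg fun x => (hFB x).1,
      calc ∫ x, F x ∂ρ ≤ ∫ _, B ∂ρ :=
            integral_mono (hFint ρ) (integrable_const _) fun x => (hFB x).2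
        _ = B := by simp⟩
  -- The drift inequality itself bounds `G`.
  have hGint : ∀ t, Integrable G (ν t) := fun t => by
    refine Integrable.of_mem_Icc 0 ((B + c) / a) hG.aemeasurable (ae_of_all _ fun x => ⟨hG0 x, ?_⟩)
    rw [le_div_iff₀ ha]
    linarith [hdrift x, (hFle (κ x)).2, (hFB x).1]
  have hstep : ∀ t, a * ∫ x, G x ∂(ν t) ≤ ∫ x, F x ∂(ν (t + 1)) - ∫ x, F x ∂(ν t) + c := by
    intro t
    have hκ : ∫ x, F x ∂(ν (t + 1)) = ∫ x, ∫ y, F y ∂(κ x) ∂(ν t) := by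
      have := hFint (ν (t + 1))
      rw [hν, Measure.comp_eq_comp_const_apply] at this ⊢
      rw [Kernel.integral_comp this, Kernel.const_apply]
    have hκint : Integrable (fun x => ∫ y, F y ∂(κ x)) (ν t) :=
      Integrable.of_mem_Icc 0 B
        (hF.stronglyMeasurable.integral_kernel (κ := κ)).measurable.aemeasurable
        (ae_of_all _ fun x => hFle (κ x))
    have h := integral_mono (((hFint (ν t)).add ((hGint t).const_mul a)).sub (integrable_const c))
      hκint hdrift
    rw [integral_sub' ((hFint (ν t)).add ((hGint t).const_mul a)) (integrable_const c),
      integral_add' (hFint (ν t)) ((hGint t).const_mul a), integral_const_mul] at h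
    simp only [integral_const, probReal_univ, one_smul] at h
    linarith
  have hsum : ∑ t ∈ Finset.range T, ∫ x, G x ∂(ν t) ≤ (B + T * c) / a := by
    rw [le_div_iff₀ ha, mul_comm, Finset.mul_sum]
    refine (Finset.sum_le_sum fun t _ => hstep t).trans ?_
    rw [Finset.sum_add_distrib, Finset.sum_range_sub fun t => ∫ x, F x ∂(ν t)]
    simp only [Finset.sum_const, Finset.card_range, nsmul_eq_mul]
    linarith [(hFle (ν T)).2, (hFle (ν 0)).1]
  simp_rw [← ofReal_integral_eq_lintegral_ofReal (hGint _) (ae_of_all _ hG0)]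
  rw [← ENNReal.ofReal_sum_of_nonneg fun t _ => integral_nonneg hG0]
  exact ENNReal.ofReal_le_ofReal hsum

variable {d H : ℕ} {S A : Type*} [MeasurableSpace S] [MeasurableSpace A]

/-- The expected squared gradient at the output, for any isotropic law of directions. -/
theorem expSqGrad_outputLaw_le {dir : Measure (Param d)} [IsProbabilityMeasure dir]
    (hdir : IsIsotropicUnit dir) (hd : 1 ≤ d) (E : RLProblem S A H) (π : PolicyNet d S A H)
    {σ : LinkFunction H} {σinv : ℝ → ℝ} {L : ℝ} (hL : 0 < L) (hσ : IsLipschitzInverse σ σinv L)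
    (hV : IsSmoothWith L (value E π)) (hp : HyperParams) (hα : hp.α = 1 / (8 * L * d))
    (hM : 1 / (hp.M : ℝ) ≤ hp.μ ^ 4) (θ₀ : Param d) :
    expSqGrad E π (outputLaw dir E π σ σinv hp θ₀) ≤
      ENNReal.ofReal (16 * L * d * H / hp.T +
        (6 * d * L ^ 2 * hp.μ ^ 2 + d * (H : ℝ) ^ 2 / (2 * hp.N * hp.μ ^ 2))) := by
  have hd' : (0 : ℝ) < d := by exact_mod_cast hd
  have hT : (0 : ℝ) < hp.T := by exact_mod_cast hp.T_pos
  have hN : (0 : ℝ) < hp.N := by exact_mod_cast hp.N_pos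
  have hμ := hp.μ_pos
  have : IsProbabilityMeasure (iterateLaw dir E π σ σinv hp θ₀ 0) :=
    Measure.dirac.isProbabilityMeasure
  have h := sum_integral_le_of_drift (step dir E π σ σinv hp) (iterateLaw dir E π σ σinv hp θ₀)
    (fun t => rfl) hV.1.continuous.measurable hV.measurable_gradient (value_mem_Icc E π)
    (fun θ => sq_nonneg _) (half_pos hp.α_pos)
    (le_integral_value_step hdir hd E π hL hσ hV hp hα hM) hp.T
  have hTinv : (hp.T : ℝ≥0∞)⁻¹ = ENNReal.ofReal ((hp.T : ℝ)⁻¹) := by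
    rw [ENNReal.ofReal_inv_of_pos hT, ENNReal.ofReal_natCast]
  rw [expSqGrad, outputLaw, lintegral_smul_measure, lintegral_finsetSum_measure, smul_eq_mul]
  calc _ ≤ (hp.T : ℝ≥0∞)⁻¹ * _ := mul_le_mul_right h _
    _ = _ := by
      rw [hTinv, ← ENNReal.ofReal_mul (by positivity), hα]
      congr 1
      field_simp
      ring

end Iteration

/-! ### Choice of the hyper-parameters -/

section HyperParameters

variable {d H : ℕ}

theorem natCeil_le_two_mul {x : ℝ} (hx : 1 ≤ x) : (⌈x⌉₊ : ℝ) ≤ 2 * x := by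
  have := Nat.ceil_lt_add_one (zero_le_one.trans hx)
  linarith

/-- Hyper-parameters that balance the three error terms, so that each is at most `ε / 3`. -/
theorem exists_hyperParams {ε L : ℝ} (hH : 1 ≤ H) (hε : 0 < ε) (hεd : ε ≤ d / 2)
    (hL : 2 * (H : ℝ) ≤ L) :
    ∃ hp : HyperParams,
      (hp.queries : ℝ) ≤ 6718464 * L ^ 7 * ((d : ℝ) ^ 8 * (H : ℝ) ^ 3 / ε ^ 5 * Real.log (d / ε)) ∧
      hp.α = 1 / (8 * L * d) ∧ 1 / (hp.M : ℝ) ≤ hp.μ ^ 4 ∧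
      16 * L * d * H / hp.T +
        (6 * d * L ^ 2 * hp.μ ^ 2 + d * (H : ℝ) ^ 2 / (2 * hp.N * hp.μ ^ 2)) ≤ ε := by
  have hH1 : (1 : ℝ) ≤ H := by exact_mod_cast hH
  have hL2 : 2 ≤ L := by linarith
  have hd0 : (0 : ℝ) < d := by linarith
  have hd1 : (1 : ℝ) ≤ d := by
    have : 0 < d := by exact_mod_cast hd0
    exact_mod_cast this
  have hdε : 2 ≤ d / ε := by
    rw [le_div_iff₀ hε]
    linarith
  -- `u` is the value of `μ²`; with `T₀`, `N₀` it makes each error term `ε / 3` before rounding, and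
  -- `M₀ = u⁻²` is the least admissible number of queries per pair.
  set q : ℝ := d / ε with hq
  set u : ℝ := ε / (18 * d * L ^ 2) with hu
  have hu0 : 0 < u := by positivity
  have hμ2 : √u ^ 2 = u := Real.sq_sqrt hu0.le
  have hμ4 : √u ^ 4 = u ^ 2 := by rw [pow_mul (√u) 2 2, hμ2]
  set T₀ : ℝ := 48 * (L * H * q) with hT₀
  set M₀ : ℝ := 324 * (d * L ^ 2 / ε) ^ 2 with hM₀
  set N₀ : ℝ := 27 * (q * L * H) ^ 2 with hN₀
  have hLH : 1 ≤ L * H := one_le_mul_of_one_le_of_one_le (by linarith) hH1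
  have hLHq : 1 ≤ L * H * q := one_le_mul_of_one_le_of_one_le hLH (by linarith)
  have hT1 : 1 ≤ T₀ := by linarith
  have hN1 : 1 ≤ N₀ := by
    have : 1 ≤ (q * L * H) ^ 2 := one_le_pow₀ (by linarith)
    linarith
  have hM1 : 1 ≤ M₀ := by
    have h : 1 ≤ d * L ^ 2 / ε := by
      rw [mul_div_right_comm]
      exact one_le_mul_of_one_le_of_one_le (by linarith) (one_le_pow₀ (by linarith))
    have : 1 ≤ (d * L ^ 2 / ε) ^ 2 := one_le_pow₀ h
    linarith
  have hlog : 1 / 2 ≤ Real.log q :=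
    calc (1 / 2 : ℝ) ≤ Real.log 2 := by linarith [Real.log_two_gt_d9]
      _ ≤ Real.log q := Real.log_le_log (by norm_num) hdε
  refine ⟨⟨1 / (8 * L * d), √u, ⌈T₀⌉₊, ⌈M₀⌉₊, ⌈N₀⌉₊, by positivity, by positivity,
    Nat.ceil_pos.2 (by linarith), Nat.ceil_pos.2 (by linarith), Nat.ceil_pos.2 (by linarith)⟩,
    ?_, rfl, ?_, ?_⟩
  · simp only [HyperParams.queries, Nat.cast_mul]
    have hp5 : (d : ℝ) ^ 5 ≤ (d : ℝ) ^ 8 := pow_le_pow_right₀ hd1 (by norm_num)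
    -- `6718464 = 2 * (2 * 48) * (2 * 324) * (2 * 27)`: three roundings and `1 / 2 ≤ log (d / ε)`.
    calc (⌈T₀⌉₊ * ⌈M₀⌉₊ * ⌈N₀⌉₊ : ℝ) ≤ 2 * T₀ * (2 * M₀) * (2 * N₀) := by
          gcongr <;> exact natCeil_le_two_mul ‹_›
      _ = 6718464 * L ^ 7 * ((d : ℝ) ^ 5 * (H : ℝ) ^ 3 / ε ^ 5 * (1 / 2)) := by
          rw [hT₀, hM₀, hN₀, hq]
          field_simp
          ring
      _ ≤ _ := by gcongr
  · rw [hμ4]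
    calc 1 / (⌈M₀⌉₊ : ℝ) ≤ 1 / M₀ := by
          gcongr
          exact Nat.le_ceil _
      _ = u ^ 2 := by
          rw [hM₀, hu]
          field_simp
          norm_num
  · simp only [hμ2]
    have h1 : 16 * L * d * H / (⌈T₀⌉₊ : ℝ) ≤ ε / 3 :=
      calc _ ≤ 16 * L * d * H / T₀ := by
            gcongr
            exact Nat.le_ceil _
        _ = ε / 3 := by
            rw [hT₀, hq]
            field_simp
            norm_num
    have h2 : 6 * d * L ^ 2 * u = ε / 3 := by
      rw [hu]
      field_simp
      norm_num
    have h3 : d * (H : ℝ) ^ 2 / (2 * ⌈N₀⌉₊ * u) ≤ ε / 3 :=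
      calc _ ≤ d * (H : ℝ) ^ 2 / (2 * N₀ * u) := by
            gcongr
            exact Nat.le_ceil _
        _ = ε / 3 := by
            rw [hN₀, hq, hu]
            field_simp
            norm_num
    linarith

end HyperParameters

end RLHF

theorem mainTheorem3 :
    ∃ C : ℝ, 0 < C ∧
      ∀ (d H : ℕ) (ε L : ℝ) (σ : RLHF.LinkFunction H) (σinv : ℝ → ℝ),
        1 ≤ H → 0 < ε → ε ≤ d / 2 → RLHF.IsLipschitzInverse σ σinv L →
        -- ZPG
        (∃ hp : RLHF.HyperParams,
          (hp.queries : ℝ) ≤ C * L ^ 7 * ((d : ℝ) ^ 8 * (H : ℝ) ^ 3 / ε ^ 5 * Real.log (d / ε)) ∧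
          ∀ (S A : Type*) [MeasurableSpace S] [MeasurableSpace A] (E : RLHF.RLProblem S A H)
            (π : RLHF.PolicyNet d S A H) (θ₀ : RLHF.Param d),
            RLHF.IsSmoothWith L (RLHF.value E π) →
            RLHF.expSqGrad E π (RLHF.zpgOutput E π σ σinv hp θ₀) ≤ ENNReal.ofReal ε) ∧
        -- ZBCPG, for every coordinate batch size
        (∀ K : ℕ, 1 ≤ K → K ≤ d → ∃ hp : RLHF.HyperParams,
          (hp.queries : ℝ) ≤ C * L ^ 7 * ((d : ℝ) ^ 8 * (H : ℝ) ^ 3 / ε ^ 5 * Real.log (d / ε)) ∧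
          ∀ (S A : Type*) [MeasurableSpace S] [MeasurableSpace A] (E : RLHF.RLProblem S A H)
            (π : RLHF.PolicyNet d S A H) (θ₀ : RLHF.Param d),
            RLHF.IsSmoothWith L (RLHF.value E π) →
            RLHF.expSqGrad E π (RLHF.zbcpgOutput K E π σ σinv hp θ₀) ≤ ENNReal.ofReal ε) := by
  refine ⟨6718464, by norm_num, fun d H ε L σ σinv hH hε hεd hσ => ?_⟩
  have hHL := hσ.two_mul_le hH
  have hL : 0 < L := by
    have : (1 : ℝ) ≤ H := by exact_mod_cast hH
    linarith
  have hd : 1 ≤ d := by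
    have : (0 : ℝ) < d := by linarith
    exact_mod_cast this
  obtain ⟨hp, hq, hα, hM, hle⟩ := RLHF.exists_hyperParams hH hε hεd hHL
  refine ⟨⟨hp, hq, fun S A _ _ E π θ₀ hV => ?_⟩, fun K hK hKd =>
    ⟨hp, hq, fun S A _ _ E π θ₀ hV => ?_⟩⟩
  · have := RLHF.isProbabilityMeasure_sphereDir hd
    exact (RLHF.expSqGrad_outputLaw_le (RLHF.isIsotropicUnit_sphereDir hd) hd E π hL hσ hV hp hα hM
      θ₀).trans (ENNReal.ofReal_le_ofReal hle)
  · have := RLHF.isProbabilityMeasure_blockDir hKd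
    exact (RLHF.expSqGrad_outputLaw_le (RLHF.isIsotropicUnit_blockDir hK hKd) hd E π hL hσ hV hp hα
      hM θ₀).trans (ENNReal.ofReal_le_ofReal hle)
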